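/- All vector bundles below are real, locally trivial, of finite rank, over an arbitrary topological space $B$, and are equipped with a continuous scalar product on the fibres. For such a bundle $\xi: E(\xi)\to B$ let $\dot\xi: \dot E(\xi)\to B$ denote its unit sphere bundle, let $$\ddot E(\xi)=\{(e,e')\in \dot E(\xi)\times\dot E(\xi) : \xi(e)=\xi(e'),\ e\perp e'\}$$ be the total space of the associated Stiefel bundle (with the subspace topology), and let $\ddot\xi:\ddot E(\xi)\to\dot E(\xi)$ be the projection $\ddot\xi(e,e')=e$. For a continuous map $p: X\to Y$, the sectional category $\mathsf{secat}[p]\in\{0,1,2,\dots,\infty\}$ is the least integer $k\ge 0$ for which $Y$ has an open cover $Y=U_0\cup U_1\cup\dots\cup U_k$ such that for every $i$ there is a continuous map $s_i:U_i\to X$ with $p(s_i(y))=y$ for all $y\in U_i$; it is $\infty$ if there is no such $k$. **Proposition 5.3.** Let the vector bundle $\xi: E(\xi)\to B$ be the Whitney sum $\xi=\xi_1\oplus\xi_2$ of vector bundles $\xi_1: E(\xi_1)\to B$ and $\xi_2: E(\xi_2)\to B$, where the scalar product on $\xi$ may be the orthogonal sum of those on $\xi_1$ and $\xi_2$ or any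 other continuous one. Then $$\mathsf{secat}[\ddot\xi:\ddot E(\xi)\to\dot E(\xi)]\ \le\ \mathsf{secat}[\dot\xi_1:\dot E(\xi_1)\to B]+\mathsf{secat}[\dot\xi_2:\dot E(\xi_2)\to B]+1 .$$ -/

import Mathlib

open Bundle

/-- `HasSectionalCover p k`: the target of `p` is covered by `k + 1` open sets `U 0, …, U k`
(possibly empty or repeated), each of which admits a continuous section of `p`. -/
def HasSectionalCover {X Y : Type*} [TopologicalSpace X] [TopologicalSpace Y]
    (p : X → Y) (k : ℕ) : Prop :=
  ∃ U : Fin (k + 1) → Set Y, (∀ i, IsOpen (U i)) ∧ (⋃ i, U i) = Set.univ ∧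
    ∀ i, ∃ s : C(U i, X), ∀ y : U i, p (s y) = y

/-- The (normalised) sectional category of a map: the least `k` for which the target has an open
cover by `k + 1` sets admitting continuous sections, and `⊤` if there is no such `k`. -/
noncomputable def secat {X Y : Type*} [TopologicalSpace X] [TopologicalSpace Y]
    (p : X → Y) : ℕ∞ :=
  sInf {n : ℕ∞ | ∃ k : ℕ, n = (k : ℕ∞) ∧ HasSectionalCover p k}

section SphereBundle

variable {B : Type*} [TopologicalSpace B]
  {F : Type*} [NormedAddCommGroup F] [NormedSpace ℝ F]
  {E : B → Type*} [TopologicalSpace (TotalSpace F E)]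
  [∀ b, TopologicalSpace (E b)] [∀ b, AddCommGroup (E b)] [∀ b, Module ℝ (E b)]
  [∀ b, IsTopologicalAddGroup (E b)] [∀ b, ContinuousConstSMul ℝ (E b)]
  [FiberBundle F E] [VectorBundle ℝ F E]

/-- The total space of the unit sphere bundle of a vector bundle with a continuous fibrewise scalar
product `g`, with the subspace topology. -/
def UnitSphereSpace (g : ContinuousRiemannianMetric F E) : Type _ :=
  {e : TotalSpace F E // g.inner e.proj e.snd e.snd = 1}

instance (g : ContinuousRiemannianMetric F E) : TopologicalSpace (UnitSphereSpace g) :=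
  inferInstanceAs (TopologicalSpace {e : TotalSpace F E // g.inner e.proj e.snd e.snd = 1})

/-- The projection of the unit sphere bundle onto the base. -/
def unitSphereProj (g : ContinuousRiemannianMetric F E) (e : UnitSphereSpace g) : B :=
  e.1.proj

/-- The total space of the associated Stiefel bundle: pairs `(e, e')` of unit vectors which lie in
the same fibre and are orthogonal, with the topology induced from the product. -/
def StiefelSpace (g : ContinuousRiemannianMetric F E) : Type _ :=
  {p : UnitSphereSpace g × UnitSphereSpace g //
    ∃ (b : B) (v w : E b), p.1.1 = ⟨b, v⟩ ∧ p.2.1 = ⟨b, w⟩ ∧ g.inner b v w = 0}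

instance (g : ContinuousRiemannianMetric F E) : TopologicalSpace (StiefelSpace g) :=
  inferInstanceAs (TopologicalSpace {p : UnitSphereSpace g × UnitSphereSpace g //
    ∃ (b : B) (v w : E b), p.1.1 = ⟨b, v⟩ ∧ p.2.1 = ⟨b, w⟩ ∧ g.inner b v w = 0})

/-- The projection `(e, e') ↦ e` of the Stiefel bundle onto the unit sphere bundle. -/
def stiefelProj (g : ContinuousRiemannianMetric F E) (p : StiefelSpace g) : UnitSphereSpace g :=
  p.1.1

end SphereBundle

/-! Local sections of the two sphere bundles give nowhere-zero fields `(v i, 0)` and `(0, w j)` in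
the Whitney sum. Where such a field is not proportional to the unit vector `e`, one Gram–Schmidt
step against `e` yields a Stiefel section (`exists_stiefel_section`), and this locus is open
(`isOpen_nonparallelSet`). No `e` is proportional to fields of both kinds, so these loci cover the
sphere bundle. The metric on the sum enters only through Gram–Schmidt, hence may be arbitrary. -/

theorem HasSectionalCover.of_fintype {X Y ι : Type*} [TopologicalSpace X] [TopologicalSpace Y]
    [Fintype ι] {p : X → Y} {k : ℕ} (hι : Fintype.card ι = k + 1) (U : ι → Set Y)
    (hU : ∀ i, IsOpen (U i)) (hcover : ∀ y, ∃ i, y ∈ U i)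
    (hs : ∀ i, ∃ s : C(U i, X), ∀ y : U i, p (s y) = y) : HasSectionalCover p k := by
  let e := (Fintype.equivFinOfCardEq hι).symm
  refine ⟨U ∘ e, fun i => hU _, Set.eq_univ_of_forall fun y => ?_, fun i => hs _⟩
  obtain ⟨i, hi⟩ := hcover y
  exact Set.mem_iUnion.2 ⟨e.symm i, by simpa using hi⟩

theorem secat_le_of_hasSectionalCover {X Y : Type*} [TopologicalSpace X] [TopologicalSpace Y]
    {p : X → Y} {k : ℕ} (h : HasSectionalCover p k) : secat p ≤ k :=
  sInf_le ⟨k, rfl, h⟩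

theorem exists_hasSectionalCover_of_secat_ne_top {X Y : Type*} [TopologicalSpace X]
    [TopologicalSpace Y] {p : X → Y} (h : secat p ≠ ⊤) :
    ∃ k : ℕ, secat p = k ∧ HasSectionalCover p k := by
  -- `ℕ∞` is well-ordered, so the infimum of a nonempty set is attained.
  refine csInf_mem (s := {n : ℕ∞ | ∃ k : ℕ, n = (k : ℕ∞) ∧ HasSectionalCover p k}) ?_
  rw [Set.nonempty_iff_ne_empty]
  intro hempty
  exact h (by rw [secat, hempty, sInf_empty])

section VectorBundle

set_option linter.unusedSectionVars false

variable {B : Type*} [TopologicalSpace B]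
  {F : Type*} [NormedAddCommGroup F] [NormedSpace ℝ F]
  {E : B → Type*} [TopologicalSpace (TotalSpace F E)]
  [∀ b, TopologicalSpace (E b)] [∀ b, AddCommGroup (E b)] [∀ b, Module ℝ (E b)]
  [FiberBundle F E] [VectorBundle ℝ F E]

theorem Continuous.add_bundle {M : Type*} [TopologicalSpace M] {b : M → B} {v w : ∀ m, E (b m)}
    (hv : Continuous fun m => TotalSpace.mk' F (b m) (v m))
    (hw : Continuous fun m => TotalSpace.mk' F (b m) (w m)) :
    Continuous fun m => TotalSpace.mk' F (b m) (v m + w m) := by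
  simp only [continuous_iff_continuousAt] at hv hw ⊢
  intro x
  have hv' := (FiberBundle.continuousAt_totalSpace F _).1 (hv x)
  have hw' := (FiberBundle.continuousAt_totalSpace F _).1 (hw x)
  refine (FiberBundle.continuousAt_totalSpace F _).2 ⟨hv'.1, (hv'.2.add hw'.2).congr ?_⟩
  have hmem := hv'.1.preimage_mem_nhds ((trivializationAt F E (b x)).open_baseSet.mem_nhds
    (FiberBundle.mem_baseSet_trivializationAt' (b x)))
  filter_upwards [hmem] with m hm
  exact (((trivializationAt F E (b x)).linear ℝ hm).map_add (v m) (w m)).symm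

theorem Continuous.smul_bundle {M : Type*} [TopologicalSpace M] {b : M → B} {v : ∀ m, E (b m)}
    {c : M → ℝ} (hc : Continuous c) (hv : Continuous fun m => TotalSpace.mk' F (b m) (v m)) :
    Continuous fun m => TotalSpace.mk' F (b m) (c m • v m) := by
  simp only [continuous_iff_continuousAt] at hc hv ⊢
  intro x
  have hv' := (FiberBundle.continuousAt_totalSpace F _).1 (hv x)
  refine (FiberBundle.continuousAt_totalSpace F _).2 ⟨hv'.1, ((hc x).smul hv'.2).congr ?_⟩
  have hmem := hv'.1.preimage_mem_nhds ((trivializationAt F E (b x)).open_baseSet.mem_nhds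
    (FiberBundle.mem_baseSet_trivializationAt' (b x)))
  filter_upwards [hmem] with m hm
  exact (((trivializationAt F E (b x)).linear ℝ hm).map_smul (c m) (v m)).symm

variable [∀ b, IsTopologicalAddGroup (E b)] [∀ b, ContinuousConstSMul ℝ (E b)]

theorem Bundle.ContinuousRiemannianMetric.continuous_inner_apply
    (g : ContinuousRiemannianMetric F E) {M : Type*}
    [TopologicalSpace M] {b : M → B} {v w : ∀ m, E (b m)}
    (hv : Continuous fun m => TotalSpace.mk' F (b m) (v m))
    (hw : Continuous fun m => TotalSpace.mk' F (b m) (w m)) :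
    Continuous fun m => g.inner (b m) (v m) (w m) := by
  have hb : Continuous b := (FiberBundle.continuous_proj F E).comp hv
  have h : Continuous (fun m => TotalSpace.mk' ℝ (E := Bundle.Trivial B ℝ) (b m)
      (g.inner (b m) (v m) (w m))) :=
    (g.continuous.comp hb).clm_bundle_apply₂ (F₁ := F) (F₂ := F) hv hw
  simp only [continuous_iff_continuousAt, FiberBundle.continuousAt_totalSpace] at h ⊢
  exact fun x => (h x).2

/-- The unit vectors `e` over `U` to which the value of the section `w` is not proportional. -/
def nonparallelSet (g : ContinuousRiemannianMetric F E) {U : Set B} (w : ∀ b : U, E b) :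
    Set (UnitSphereSpace g) :=
  {e | ∃ h : e.1.proj ∈ U,
    w ⟨_, h⟩ + (-g.inner _ (w ⟨_, h⟩) e.1.snd) • e.1.snd ≠ 0}

theorem continuous_orthogonal_part (g : ContinuousRiemannianMetric F E) {U : Set B}
    {w : ∀ b : U, E b} (hw : Continuous fun b : U => TotalSpace.mk' F (b : B) (w b))
    {M : Type*} [TopologicalSpace M] {f : M → UnitSphereSpace g} (hf : Continuous f)
    (h : ∀ m, (f m).1.proj ∈ U) :
    Continuous fun m => TotalSpace.mk' F (f m).1.proj
      (w ⟨_, h m⟩ + (-g.inner _ (w ⟨_, h m⟩) (f m).1.snd) • (f m).1.snd) := by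
  have he : Continuous fun m => TotalSpace.mk' F (f m).1.proj (f m).1.snd :=
    continuous_subtype_val.comp hf
  have hb : Continuous fun m => (f m).1.proj := (FiberBundle.continuous_proj F E).comp he
  have hw' : Continuous fun m => TotalSpace.mk' F (f m).1.proj (w ⟨_, h m⟩) :=
    hw.comp (hb.subtype_mk h)
  exact hw'.add_bundle ((g.continuous_inner_apply hw' he).neg.smul_bundle he)

/-- By positive definiteness, the part of `w` orthogonal to `e` is nonzero exactly when its squared
length, a continuous real function over the preimage of `U`, is nonzero. -/
theorem isOpen_nonparallelSet (g : ContinuousRiemannianMetric F E) {U : Set B} (hU : IsOpen U)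
    {w : ∀ b : U, E b} (hw : Continuous fun b : U => TotalSpace.mk' F (b : B) (w b)) :
    IsOpen (nonparallelSet g w) := by
  have hproj : Continuous fun e : UnitSphereSpace g => e.1.proj :=
    (FiberBundle.continuous_proj F E).comp continuous_subtype_val
  let M := {e : UnitSphereSpace g // e.1.proj ∈ U}
  have hr := continuous_orthogonal_part g hw (M := M) continuous_subtype_val (fun m => m.2)
  have hopen := isOpen_compl_singleton (x := (0 : ℝ)).preimage (g.continuous_inner_apply hr hr)
  convert (hU.preimage hproj).isOpenMap_subtype_val _ hopen using 1
  ext e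
  constructor
  · rintro ⟨h, hne⟩
    exact ⟨⟨e, h⟩, (g.pos _ _ hne).ne', rfl⟩
  · rintro ⟨⟨e, h⟩, hne, rfl⟩
    refine ⟨h, fun h0 => hne ?_⟩
    simp only [Set.mem_singleton_iff]
    rw [h0]
    simp

theorem exists_stiefel_section (g : ContinuousRiemannianMetric F E) {U : Set B}
    {w : ∀ b : U, E b} (hw : Continuous fun b : U => TotalSpace.mk' F (b : B) (w b)) :
    ∃ s : C(nonparallelSet g w, StiefelSpace g), ∀ y, stiefelProj g (s y) = y := by
  let r : ∀ y : nonparallelSet g w, E y.1.1.proj := fun y =>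
    w ⟨_, y.2.1⟩ + (-g.inner _ (w ⟨_, y.2.1⟩) y.1.1.snd) • y.1.1.snd
  have hr : Continuous fun y => TotalSpace.mk' F y.1.1.proj (r y) :=
    continuous_orthogonal_part g hw continuous_subtype_val (fun m => m.2.1)
  have hpos : ∀ y, 0 < g.inner _ (r y) (r y) := fun y => g.pos _ _ y.2.2
  let c : nonparallelSet g w → ℝ := fun y => (√(g.inner _ (r y) (r y)))⁻¹
  have hc : Continuous c := (g.continuous_inner_apply hr hr).sqrt.inv₀ fun y =>
    (Real.sqrt_pos.2 (hpos y)).ne'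
  have hunit : ∀ y, g.inner _ (c y • r y) (c y • r y) = 1 := fun y => by
    have hsq := Real.mul_self_sqrt (hpos y).le
    have hne := (Real.sqrt_pos.2 (hpos y)).ne'
    simp only [map_smul, smul_apply, smul_eq_mul, c]
    field_simp
    rw [sq, hsq]
  have horth : ∀ y, g.inner _ y.1.1.snd (c y • r y) = 0 := fun y => by
    have he := y.1.2
    have hs := g.symm _ (w ⟨_, y.2.1⟩) y.1.1.snd
    -- The cancellation uses `g(e, e) = 1` and the symmetry of `g`.
    simp only [map_smul, map_add, smul_eq_mul, r, he, hs]
    ring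
  refine ⟨⟨fun y => ⟨(y.1, ⟨⟨y.1.1.proj, c y • r y⟩, hunit y⟩), y.1.1.proj, y.1.1.snd, c y • r y,
    rfl, rfl, horth y⟩, ?_⟩, fun y => rfl⟩
  exact (continuous_subtype_val.prodMk ((hc.smul_bundle hr).subtype_mk _)).subtype_mk _

theorem exists_smul_eq_of_notMem_nonparallelSet (g : ContinuousRiemannianMetric F E) {U : Set B}
    {w : ∀ b : U, E b} {e : UnitSphereSpace g} (h : e.1.proj ∈ U) (he : e ∉ nonparallelSet g w) :
    ∃ c : ℝ, w ⟨_, h⟩ = c • e.1.snd := by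
  refine ⟨g.inner _ (w ⟨_, h⟩) e.1.snd, ?_⟩
  by_contra hne
  refine he ⟨h, fun h0 => hne ?_⟩
  rwa [neg_smul, ← sub_eq_add_neg, sub_eq_zero] at h0

theorem exists_unit_section (g : ContinuousRiemannianMetric F E) {U : Set B}
    {s : C(U, UnitSphereSpace g)} (hs : ∀ y, unitSphereProj g (s y) = y) :
    ∃ v : ∀ b : U, E b, (Continuous fun b : U => TotalSpace.mk' F (b : B) (v b)) ∧
      ∀ b, v b ≠ 0 := by
  have h : ∀ b : U, ∃ v : E b, (s b).1 = TotalSpace.mk' F (b : B) v := fun b => by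
    have hb : (s b).1.proj = b := hs b
    rcases hsb : (s b).1 with ⟨b', v⟩
    rw [hsb] at hb
    obtain rfl : b' = b := hb
    exact ⟨v, rfl⟩
  choose v hv using h
  refine ⟨v, ?_, fun b hb => ?_⟩
  · simp only [← hv]
    exact continuous_subtype_val.comp s.continuous
  · have h1 := (s b).2
    rw [hv b, hb] at h1
    simp at h1

end VectorBundle

theorem proposition5p3
    {B : Type*} [TopologicalSpace B]
    {F₁ : Type*} [NormedAddCommGroup F₁] [NormedSpace ℝ F₁] [FiniteDimensional ℝ F₁]
    {E₁ : B → Type*} [TopologicalSpace (TotalSpace F₁ E₁)]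
    [∀ b, TopologicalSpace (E₁ b)] [∀ b, AddCommGroup (E₁ b)] [∀ b, Module ℝ (E₁ b)]
    [∀ b, IsTopologicalAddGroup (E₁ b)] [∀ b, ContinuousConstSMul ℝ (E₁ b)]
    [FiberBundle F₁ E₁] [VectorBundle ℝ F₁ E₁]
    {F₂ : Type*} [NormedAddCommGroup F₂] [NormedSpace ℝ F₂] [FiniteDimensional ℝ F₂]
    {E₂ : B → Type*} [TopologicalSpace (TotalSpace F₂ E₂)]
    [∀ b, TopologicalSpace (E₂ b)] [∀ b, AddCommGroup (E₂ b)] [∀ b, Module ℝ (E₂ b)]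
    [∀ b, IsTopologicalAddGroup (E₂ b)] [∀ b, ContinuousConstSMul ℝ (E₂ b)]
    [FiberBundle F₂ E₂] [VectorBundle ℝ F₂ E₂]
    (g₁ : ContinuousRiemannianMetric F₁ E₁) (g₂ : ContinuousRiemannianMetric F₂ E₂)
    (g : ContinuousRiemannianMetric (F₁ × F₂) (E₁ ×ᵇ E₂)) :
    secat (stiefelProj g) ≤ secat (unitSphereProj g₁) + secat (unitSphereProj g₂) + 1 := by
  by_cases h₁ : secat (unitSphereProj g₁) = ⊤
  · simp [h₁]
  by_cases h₂ : secat (unitSphereProj g₂) = ⊤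
  · simp [h₂]
  obtain ⟨k, hk, U, hU, hUcover, hUs⟩ := exists_hasSectionalCover_of_secat_ne_top h₁
  obtain ⟨l, hl, V, hV, hVcover, hVs⟩ := exists_hasSectionalCover_of_secat_ne_top h₂
  rw [hk, hl]
  choose s hs using hUs
  choose t ht using hVs
  choose v hv hv0 using fun i => exists_unit_section g₁ (hs i)
  choose w hw hw0 using fun j => exists_unit_section g₂ (ht j)
  -- The sum's total space carries the topology induced from the product of the two total spaces, so
  -- it suffices to pair with the zero section.
  have hv' : ∀ i, Continuous fun b : U i =>
      TotalSpace.mk' (F₁ × F₂) (E := E₁ ×ᵇ E₂) (b : B) (v i b, 0) := fun i =>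
    (FiberBundle.Prod.isInducing_diag F₁ E₁ F₂ E₂).continuous_iff.2
      ((hv i).prodMk ((Bundle.Trivialization.continuous_zeroSection ℝ (F := F₂) (E := E₂)).comp continuous_subtype_val))
  have hw' : ∀ j, Continuous fun b : V j =>
      TotalSpace.mk' (F₁ × F₂) (E := E₁ ×ᵇ E₂) (b : B) (0, w j b) := fun j =>
    (FiberBundle.Prod.isInducing_diag F₁ E₁ F₂ E₂).continuous_iff.2
      (((Bundle.Trivialization.continuous_zeroSection ℝ (F := F₁) (E := E₁)).comp continuous_subtype_val).prodMk (hw j))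
  refine (secat_le_of_hasSectionalCover (k := k + l + 1) ?_).trans (by push_cast; exact le_rfl)
  -- There are `(k + 1) + (l + 1)` sets, whence the extra `1` in the bound.
  refine HasSectionalCover.of_fintype (ι := Fin (k + 1) ⊕ Fin (l + 1)) (by simp; ring)
    (Sum.elim (fun i => nonparallelSet g (U := U i) fun b => (v i b, 0))
      (fun j => nonparallelSet g (U := V j) fun b => (0, w j b))) ?_ ?_ ?_
  · rintro (i | j)
    exacts [isOpen_nonparallelSet g (hU i) (hv' i), isOpen_nonparallelSet g (hV j) (hw' j)]
  · intro e
    obtain ⟨i, hi⟩ := Set.mem_iUnion.1 (hUcover.symm ▸ Set.mem_univ e.1.proj)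
    obtain ⟨j, hj⟩ := Set.mem_iUnion.1 (hVcover.symm ▸ Set.mem_univ e.1.proj)
    by_contra! hcon
    obtain ⟨c, hc⟩ := exists_smul_eq_of_notMem_nonparallelSet g
      (w := fun b : U i => (v i b, 0)) hi (hcon (Sum.inl i))
    obtain ⟨d, hd⟩ := exists_smul_eq_of_notMem_nonparallelSet g
      (w := fun b : V j => (0, w j b)) hj (hcon (Sum.inr j))
    have hc1 : v i ⟨_, hi⟩ = c • e.1.snd.1 := congrArg Prod.fst hc
    have hd1 : 0 = d • e.1.snd.1 := congrArg Prod.fst hd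
    have hd2 : w j ⟨_, hj⟩ = d • e.1.snd.2 := congrArg Prod.snd hd
    -- Either `d = 0`, which kills `w j`, or the first component of `e` vanishes, which kills `v i`.
    rcases smul_eq_zero.1 hd1.symm with h | h
    · exact hw0 j _ (by rw [hd2, h, zero_smul])
    · exact hv0 i _ (by rw [hc1, h, smul_zero])
  · rintro (i | j)
    exacts [exists_stiefel_section g (hv' i), exists_stiefel_section g (hw' j)]
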